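/- Let $\mathcal H$ be a complex Hilbert space with an orthogonal splitting $\mathcal H=H_1\oplus H_2$ into closed subspaces, let $P_1$ be the orthogonal projection onto $H_1$, and let $\Omega$ be a (possibly unbounded) self-adjoint operator in $\mathcal H$ of the block form $$\Omega=\begin{bmatrix}\Omega_1&\Gamma\\ \Gamma^\dagger&\Omega_2\end{bmatrix},\qquad \mathrm{Dom}\,\Omega=\mathrm{Dom}\,\Omega_1\oplus\mathrm{Dom}\,\Omega_2,$$ where $\Omega_i$ is a linear operator in $H_i$ with domain $\mathrm{Dom}\,\Omega_i$ ($i=1,2$) and $\Gamma:H_2\to H_1$ is bounded. Put $H_{1\Gamma}=\overline{\mathrm{Ran}\,\Gamma}\subseteq H_1$ and $H_{2\Gamma}=\overline{\mathrm{Ran}\,\Gamma^\dagger}\subseteq H_2$, and let $U:H_{1\Gamma}\to H_{2\Gamma}$ be the unitary factor of the polar decomposition $\Gamma^\dagger=U(\Gamma\Gamma^\dagger)^{1/2}$. Let $H_0$ be a Hilbert space with unitary operators $U_1:H_0\to H_{1\Gamma}$ and $U_2:H_0\to H_{2\Gamma}$ such that $U_2U_1^{-1}=U$, and let $\Gamma_0=U_1^{-1}\Gamma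 U_2=U_2^{-1}\Gamma^\dagger U_1$ be the operator on $H_0$ that represents $\Gamma$. For a set $X$ with a $\sigma$-algebra $\mathcal B$ of subsets, a resolution of the identity on a Hilbert space $K$ is a map $\pi:\mathcal B\to\mathcal L(K)$ such that, for all $A,B\in\mathcal B$: $\pi(A)$ is an orthogonal projection; $\pi(\emptyset)=0$ and $\pi(X)=\mathbb I_K$; $\pi(X\setminus A)=\mathbb I_K-\pi(A)$; $\pi(A\cap B)=\pi(A)\pi(B)$; $\pi(A\cup B)=\pi(A)+\pi(B)$ if $A\cap B=\emptyset$; and $\pi(\bigcap_{n}A_n)=\mathrm{s\text{-}lim}_{n\to\infty}\,\pi(A_n)$ for every decreasing sequence $(A_n)$ in $\mathcal B$. It commutes with an operator $T$ in $K$ if, for every $A\in\mathcal B$, $\pi(A)$ maps $\mathrm{Dom}\,T$ into itself and $\pi(A)Tv=T\pi(A)v$ for all $v\in\mathrm{Dom}\,T$. Theorem. Let $\pi:\mathcal B\to\mathcal L(\mathcal H)$ be a resolution of the identity on $\mathcal H$ that commutes with $\Omega$ and $P_1$. Then there exists a resolution of the identity $E_\pi:\mathcal B\to\mathcal L(H_0)$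 on $H_0$ that commutes with $\Gamma_0$ and satisfies, for all $A\in\mathcal B$, $$U_iE_\pi(A)=\pi(A)U_i,\qquad \mathrm{Ran}\,(U_iE_\pi(A))=\mathrm{Ran}\,\pi(A)\cap H_{i\Gamma},\qquad i=1,2.$$ -/

import Mathlib

open Filter Topology
open scoped InnerProduct

noncomputable section

namespace CoupledSystem

/-! ### Resolutions of the identity -/

section Resolution

/-- A resolution of the identity of the Hilbert space `H` over the measurable space `X`: a
projection-valued set function on the `σ`-algebra of `X`.  Only the values `π A` at measurable sets
`A` are meaningful. -/
structure IsResolutionOfIdentity {X : Type*} [MeasurableSpace X] {H : Type*}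
    [NormedAddCommGroup H] [InnerProductSpace ℂ H] [CompleteSpace H]
    (π : Set X → H →L[ℂ] H) : Prop where
  /-- Every value is an orthogonal projection (idempotent and self-adjoint). -/
  isStarProjection : ∀ A, MeasurableSet A → IsStarProjection (π A)
  empty : π ∅ = 0
  univ : π Set.univ = 1
  compl : ∀ A, MeasurableSet A → π Aᶜ = 1 - π A
  inter : ∀ A B, MeasurableSet A → MeasurableSet B → π (A ∩ B) = π A * π B
  union : ∀ A B, MeasurableSet A → MeasurableSet B → A ∩ B = ∅ → π (A ∪ B) = π A + π B
  /-- Continuity from above in the strong operator topology. -/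
  iInter : ∀ A : ℕ → Set X, (∀ n, MeasurableSet (A n)) → (∀ n, A (n + 1) ⊆ A n) →
    ∀ v : H, Tendsto (fun n => π (A n) v) atTop (𝓝 (π (⋂ n, A n) v))

/-- `π` commutes with the bounded operator `T`. -/
def CommutesWith {X : Type*} [MeasurableSpace X] {H : Type*}
    [NormedAddCommGroup H] [InnerProductSpace ℂ H]
    (π : Set X → H →L[ℂ] H) (T : H →L[ℂ] H) : Prop :=
  ∀ A, MeasurableSet A → π A ∘L T = T ∘L π A

/-- `π` commutes with the (possibly unbounded) operator `T`, i.e. `π A T ⊆ T π A`: each `π A`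
maps the domain of `T` into itself, and `π A T v = T π A v` on that domain. -/
def CommutesWithUnbounded {X : Type*} [MeasurableSpace X] {H : Type*}
    [NormedAddCommGroup H] [InnerProductSpace ℂ H]
    (π : Set X → H →L[ℂ] H) (T : H →ₗ.[ℂ] H) : Prop :=
  ∀ A, MeasurableSet A → ∀ v : T.domain,
    ∃ h : π A (v : H) ∈ T.domain, π A (T v) = T ⟨π A (v : H), h⟩

end Resolution

/-! ### The polar isometry of a bounded operator `Γ : H₂ → H₁` -/

section Polar

variable {H₁ H₂ : Type*}
  [NormedAddCommGroup H₁] [InnerProductSpace ℂ H₁] [CompleteSpace H₁]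
  [NormedAddCommGroup H₂] [InnerProductSpace ℂ H₂] [CompleteSpace H₂]

/-- The closure of the range of a bounded operator. -/
abbrev clRan (Γ : H₂ →L[ℂ] H₁) : Submodule ℂ H₁ := Γ.range.topologicalClosure

/-- The positive part `(Γ Γ†)^{1/2}` of `Γ†`. -/
def absAdjoint (Γ : H₂ →L[ℂ] H₁) : H₁ →L[ℂ] H₁ := CFC.sqrt (Γ ∘L Γ.adjoint)

theorem mem_clRan (Γ : H₂ →L[ℂ] H₁) (y : H₂) : Γ y ∈ clRan Γ :=
  Γ.range.le_topologicalClosure ⟨y, rfl⟩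

theorem isSelfAdjoint_absAdjoint (Γ : H₂ →L[ℂ] H₁) : (absAdjoint Γ).adjoint = absAdjoint Γ :=
  (IsSelfAdjoint.of_nonneg (CFC.sqrt_nonneg (Γ ∘L Γ.adjoint))).adjoint_eq

theorem absAdjoint_mul_self (Γ : H₂ →L[ℂ] H₁) :
    absAdjoint Γ ∘L absAdjoint Γ = Γ ∘L Γ.adjoint :=
  CFC.sqrt_mul_sqrt_self (Γ ∘L Γ.adjoint)
    ((ContinuousLinearMap.nonneg_iff_isPositive _).2 Γ.isPositive_self_comp_adjoint)

theorem norm_absAdjoint (Γ : H₂ →L[ℂ] H₁) (x : H₁) : ‖absAdjoint Γ x‖ = ‖Γ.adjoint x‖ := by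
  have h : inner ℂ (absAdjoint Γ x) (absAdjoint Γ x)
      = inner ℂ (Γ.adjoint x) (Γ.adjoint x) := by
    rw [← ContinuousLinearMap.adjoint_inner_right, isSelfAdjoint_absAdjoint,
      ContinuousLinearMap.adjoint_inner_left, ← ContinuousLinearMap.comp_apply,
      absAdjoint_mul_self, ContinuousLinearMap.comp_apply]
  rw [inner_self_eq_norm_sq_to_K, inner_self_eq_norm_sq_to_K] at h
  have h' : ‖absAdjoint Γ x‖ ^ 2 = ‖Γ.adjoint x‖ ^ 2 := by exact_mod_cast h
  exact (pow_left_inj₀ (norm_nonneg _) (norm_nonneg _) two_ne_zero).1 h'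

theorem clRan_absAdjoint (Γ : H₂ →L[ℂ] H₁) : clRan (absAdjoint Γ) = clRan Γ := by
  have hk : (absAdjoint Γ).ker = Γ.adjoint.ker := by
    ext x
    simp only [LinearMap.mem_ker, ContinuousLinearMap.coe_coe]
    rw [← norm_eq_zero, norm_absAdjoint, norm_eq_zero]
  rw [clRan, clRan, ← Submodule.orthogonal_orthogonal_eq_closure,
    ← Submodule.orthogonal_orthogonal_eq_closure, ContinuousLinearMap.orthogonal_range,
    ContinuousLinearMap.orthogonal_range, isSelfAdjoint_absAdjoint, hk]

theorem absAdjoint_mem (Γ : H₂ →L[ℂ] H₁) (x : H₁) : absAdjoint Γ x ∈ clRan Γ :=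
  clRan_absAdjoint Γ ▸ mem_clRan (absAdjoint Γ) x

theorem denseRange_codRestrict {E F : Type*} [NormedAddCommGroup E] [InnerProductSpace ℂ E]
    [NormedAddCommGroup F] [InnerProductSpace ℂ F] (T : E →L[ℂ] F) (K : Submodule ℂ F)
    (hK : T.range.topologicalClosure = K) (hT : ∀ x, T x ∈ K) :
    DenseRange (T.codRestrict K hT) := by
  rintro ⟨y, hy⟩
  rw [closure_subtype]
  have : (fun z : K => (z : F)) '' Set.range (T.codRestrict K hT) = (T.range : Set F) := by
    ext z
    constructor
    · rintro ⟨_, ⟨x, rfl⟩, rfl⟩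
      exact ⟨x, rfl⟩
    · rintro ⟨x, rfl⟩
      exact ⟨_, ⟨x, rfl⟩, rfl⟩
  change y ∈ closure ((fun z : K => (z : F)) '' Set.range (T.codRestrict K hT))
  rw [this]
  subst hK
  exact hy

/-- Polar decomposition `Γ† = U (Γ Γ†)^{1/2}`, with `U` a unitary from the closure of `Ran Γ`
onto the closure of `Ran Γ†`. -/
theorem existsUnique_polarIsometry (Γ : H₂ →L[ℂ] H₁) :
    ∃! U : clRan Γ ≃ₗᵢ[ℂ] clRan Γ.adjoint,
      ∀ x : H₁, (U ⟨absAdjoint Γ x, absAdjoint_mem Γ x⟩ : H₂) = Γ.adjoint x := by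
  let e : H₁ →L[ℂ] clRan Γ := (absAdjoint Γ).codRestrict (clRan Γ) (absAdjoint_mem Γ)
  let f : H₁ →L[ℂ] clRan Γ.adjoint :=
    Γ.adjoint.codRestrict (clRan Γ.adjoint) (mem_clRan Γ.adjoint)
  have he : DenseRange e := denseRange_codRestrict _ _ (clRan_absAdjoint Γ) _
  have hf : DenseRange f := denseRange_codRestrict _ _ rfl _
  have hn : ∀ x, ‖f x‖ = ‖e x‖ := fun x => (norm_absAdjoint Γ x).symm
  let u : clRan Γ →L[ℂ] clRan Γ.adjoint := LinearMap.extendOfNorm (f : H₁ →ₗ[ℂ] _) (e : H₁ →ₗ[ℂ] _)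
  have hu : ∀ x, u (e x) = f x := fun x =>
    LinearMap.extendOfNorm_eq he ⟨1, fun x => by simpa using (hn x).le⟩ x
  have hnorm : ∀ y, ‖u y‖ = ‖y‖ := by
    intro y
    refine he.induction_on y (isClosed_eq (by fun_prop) (by fun_prop)) ?_
    intro x
    rw [hu, hn]
  let ui : clRan Γ →ₗᵢ[ℂ] clRan Γ.adjoint := ⟨u, hnorm⟩
  have hsurj : Function.Surjective ui := by
    have hcl : IsClosed (Set.range ui) := ui.isometry.isClosedEmbedding.isClosed_range
    have hd : DenseRange ui := hf.mono (by
      rintro _ ⟨x, rfl⟩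
      exact ⟨e x, hu x⟩)
    rw [← Set.range_eq_univ, ← hcl.closure_eq]
    exact hd.closure_range
  refine ⟨LinearIsometryEquiv.ofSurjective ui hsurj, fun x => ?_, ?_⟩
  · exact congrArg Subtype.val (hu x)
  · intro V hV
    have : (V : clRan Γ → clRan Γ.adjoint) = ui := by
      refine he.equalizer V.continuous ui.continuous ?_
      funext x
      apply Subtype.ext
      exact (hV x).trans (congrArg Subtype.val (hu x)).symm
    ext y
    exact congrArg Subtype.val (congrFun this y)

/-- The canonical unitary `U = Γ† (Γ Γ†)^{-1/2}` from the closure of `Ran Γ` onto the closure of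
`Ran Γ†`, that is, the unitary factor of the polar decomposition `Γ† = U (Γ Γ†)^{1/2}`. -/
def polarIsometry (Γ : H₂ →L[ℂ] H₁) : clRan Γ ≃ₗᵢ[ℂ] clRan Γ.adjoint :=
  (existsUnique_polarIsometry Γ).choose

theorem polarIsometry_absAdjoint (Γ : H₂ →L[ℂ] H₁) (x : H₁) :
    (polarIsometry Γ ⟨absAdjoint Γ x, absAdjoint_mem Γ x⟩ : H₂) = Γ.adjoint x :=
  (existsUnique_polarIsometry Γ).choose_spec.1 x

/-- `Γ_R`: the operator `Γ` restricted to (the closures of) `Ran Γ†` and `Ran Γ`, both in domain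
and in target. -/
def restrictRan (Γ : H₂ →L[ℂ] H₁) : clRan Γ.adjoint →L[ℂ] clRan Γ :=
  (Γ ∘L (clRan Γ.adjoint).subtypeL).codRestrict (clRan Γ) fun y => mem_clRan Γ y

/-- A model of the coupling operator `Γ` on a Hilbert space `H₀`: unitaries `U₁` of `H₀` onto the
closure of `Ran Γ` and `U₂` of `H₀` onto the closure of `Ran Γ†`, with `U₂ U₁⁻¹ = U`. -/
structure Model (Γ : H₂ →L[ℂ] H₁) (H₀ : Type*) [NormedAddCommGroup H₀]
    [InnerProductSpace ℂ H₀] where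
  U₁ : H₀ ≃ₗᵢ[ℂ] clRan Γ
  U₂ : H₀ ≃ₗᵢ[ℂ] clRan Γ.adjoint
  symm_trans : U₁.symm.trans U₂ = polarIsometry Γ

/-- The model operator `Γ₀ = U₁⁻¹ Γ U₂` on `H₀`. -/
def Model.Γ₀ {Γ : H₂ →L[ℂ] H₁} {H₀ : Type*} [NormedAddCommGroup H₀] [InnerProductSpace ℂ H₀]
    (M : Model Γ H₀) : H₀ →L[ℂ] H₀ :=
  (M.U₁.symm : clRan Γ →L[ℂ] H₀) ∘L restrictRan Γ ∘L (M.U₂ : H₀ →L[ℂ] clRan Γ.adjoint)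

/-- `Γ U = (Γ Γ†)^{1/2}` on the closure of `Ran Γ`. -/
theorem apply_polarIsometry (Γ : H₂ →L[ℂ] H₁) (y : clRan Γ) :
    Γ (polarIsometry Γ y) = absAdjoint Γ y := by
  have hd := denseRange_codRestrict (absAdjoint Γ) (clRan Γ) (clRan_absAdjoint Γ)
    (absAdjoint_mem Γ)
  refine hd.induction_on y (isClosed_eq (by fun_prop) (by fun_prop)) fun x => ?_
  change Γ (polarIsometry Γ ⟨absAdjoint Γ x, absAdjoint_mem Γ x⟩) = absAdjoint Γ (absAdjoint Γ x)
  rw [polarIsometry_absAdjoint]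
  exact (DFunLike.congr_fun (absAdjoint_mul_self Γ) x).symm

/-- The other expression for the model operator: `Γ₀ = U₂⁻¹ Γ† U₁`. -/
theorem Model.U₂_Γ₀ {Γ : H₂ →L[ℂ] H₁} {H₀ : Type*} [NormedAddCommGroup H₀]
    [InnerProductSpace ℂ H₀] (M : Model Γ H₀) (u : H₀) :
    (M.U₂ (M.Γ₀ u) : H₂) = Γ.adjoint (M.U₁ u) := by
  have h : ∀ w, M.U₂ w = polarIsometry Γ (M.U₁ w) := fun w => by
    rw [← M.symm_trans]
    simp
  have hΓ : M.U₁ (M.Γ₀ u) = ⟨absAdjoint Γ (M.U₁ u), absAdjoint_mem Γ _⟩ := by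
    apply Subtype.ext
    have : M.U₁ (M.Γ₀ u) = restrictRan Γ (M.U₂ u) := M.U₁.apply_symm_apply _
    rw [this, h u]
    exact apply_polarIsometry Γ _
  rw [h, hΓ, polarIsometry_absAdjoint]

/-- The canonical model, with `H₀` the closure of `Ran Γ`, `U₁ = I` and `U₂ = U`. -/
def Model.canonical (Γ : H₂ →L[ℂ] H₁) : Model Γ (clRan Γ) where
  U₁ := LinearIsometryEquiv.refl ℂ _
  U₂ := polarIsometry Γ
  symm_trans := rfl

end Polar

/-! ### Coupled systems -/

section System

variable {H : Type*} [NormedAddCommGroup H] [InnerProductSpace ℂ H] [CompleteSpace H]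

/-- The frequency operator of a coupled system, given in block form with respect to
`H = H₁ ⊕ H₁ᗮ` by
`Ω = [Ω₁, Γ; Γ†, Ω₂]`, with domain `Dom Ω₁ ⊕ Dom Ω₂`. -/
def blockOperator (H₁ : Submodule ℂ H) [CompleteSpace H₁]
    (Ω₁ : H₁ →ₗ.[ℂ] H₁) (Ω₂ : H₁ᗮ →ₗ.[ℂ] H₁ᗮ) (Γ : H₁ᗮ →L[ℂ] H₁) : H →ₗ.[ℂ] H where
  domain :=
    Ω₁.domain.comap (H₁.orthogonalProjectionOnto : H →ₗ[ℂ] H₁) ⊓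
      Ω₂.domain.comap (H₁ᗮ.orthogonalProjectionOnto : H →ₗ[ℂ] H₁ᗮ)
  toFun :=
    { toFun := fun v =>
        ((Ω₁ ⟨H₁.orthogonalProjectionOnto v, v.2.1⟩
          + Γ (H₁ᗮ.orthogonalProjectionOnto (v : H)) : H₁) : H)
        + ((Γ.adjoint (H₁.orthogonalProjectionOnto (v : H))
          + Ω₂ ⟨H₁ᗮ.orthogonalProjectionOnto v, v.2.2⟩ : H₁ᗮ) : H)
      map_add' := by
        intro v w
        have h₁ : Ω₁ ⟨H₁.orthogonalProjectionOnto ((v + w : _) : H), (v + w).2.1⟩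
            = Ω₁ ⟨H₁.orthogonalProjectionOnto v, v.2.1⟩
              + Ω₁ ⟨H₁.orthogonalProjectionOnto w, w.2.1⟩ := by
          rw [← LinearPMap.map_add]
          congr 1
          exact Subtype.ext (by simp)
        have h₂ : Ω₂ ⟨H₁ᗮ.orthogonalProjectionOnto ((v + w : _) : H), (v + w).2.2⟩
            = Ω₂ ⟨H₁ᗮ.orthogonalProjectionOnto v, v.2.2⟩
              + Ω₂ ⟨H₁ᗮ.orthogonalProjectionOnto w, w.2.2⟩ := by
          rw [← LinearPMap.map_add]
          congr 1
          exact Subtype.ext (by simp)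
        rw [h₁, h₂]
        simp only [Submodule.coe_add, map_add]
        abel
      map_smul' := by
        intro c v
        have h₁ : Ω₁ ⟨H₁.orthogonalProjectionOnto ((c • v : _) : H), (c • v).2.1⟩
            = c • Ω₁ ⟨H₁.orthogonalProjectionOnto v, v.2.1⟩ := by
          rw [← LinearPMap.map_smul]
          congr 1
          exact Subtype.ext (by simp)
        have h₂ : Ω₂ ⟨H₁ᗮ.orthogonalProjectionOnto ((c • v : _) : H), (c • v).2.2⟩
            = c • Ω₂ ⟨H₁ᗮ.orthogonalProjectionOnto v, v.2.2⟩ := by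
          rw [← LinearPMap.map_smul]
          congr 1
          exact Subtype.ext (by simp)
        rw [h₁, h₂]
        simp only [Submodule.coe_smul, map_smul, smul_add, Submodule.coe_add, RingHom.id_apply] }

variable {H₁ : Submodule ℂ H} [CompleteSpace H₁] {Γ : H₁ᗮ →L[ℂ] H₁}
  {H₀ : Type*} [NormedAddCommGroup H₀] [InnerProductSpace ℂ H₀]

/-- `H_{1Γ}`, the closure of `Ran Γ`, as a subspace of `H`. -/
def H₁Γ (Γ : H₁ᗮ →L[ℂ] H₁) : Submodule ℂ H := (clRan Γ).map H₁.subtype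

/-- `H_{2Γ}`, the closure of `Ran Γ†`, as a subspace of `H`. -/
def H₂Γ (Γ : H₁ᗮ →L[ℂ] H₁) : Submodule ℂ H := (clRan Γ.adjoint).map H₁ᗮ.subtype

/-- `U₁` as an operator from `H₀` into `H`. -/
def Model.V₁ (M : Model Γ H₀) : H₀ →L[ℂ] H :=
  H₁.subtypeL ∘L (clRan Γ).subtypeL ∘L (M.U₁ : H₀ →L[ℂ] clRan Γ)

/-- `U₂` as an operator from `H₀` into `H`. -/
def Model.V₂ (M : Model Γ H₀) : H₀ →L[ℂ] H :=
  H₁ᗮ.subtypeL ∘L (clRan Γ.adjoint).subtypeL ∘L (M.U₂ : H₀ →L[ℂ] clRan Γ.adjoint)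

end System

end CoupledSystem

end

/-!
A bounded operator `T` that commutes with `P₁` is block diagonal, `T = T₁ ⊕ T₂`.  If it also
commutes with `Ω`, comparing the `H₁`-components of `T Ω v = Ω T v` for `v` in the dense subspace
`Dom Ω₂` gives `T₁ Γ = Γ T₂`, and `T₂ Γ† = Γ† T₁` follows by taking adjoints when `T` is
self-adjoint.  Hence `T₁` leaves the closure of `Ran Γ` invariant and commutes with `(Γ Γ†)^{1/2}`,
so the polar unitary intertwines `T₁` with `T₂`: the operators `U₁⁻¹ T₁ U₁` and `U₂⁻¹ T₂ U₂` on
`H₀` coincide.  Applied to `T = π A` they form the required resolution of the identity.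
-/

noncomputable section

namespace CoupledSystem

section Range

variable {R M N : Type*} [Semiring R] [AddCommMonoid M] [AddCommMonoid N] [Module R M] [Module R N]

theorem range_comp_eq_range_inf_range {V : N →ₗ[R] M} {E : N →ₗ[R] N} {T : M →ₗ[R] M}
    (hT : IsIdempotentElem T) (h : V ∘ₗ E = T ∘ₗ V) : (V ∘ₗ E).range = T.range ⊓ V.range := by
  refine le_antisymm (le_inf ?_ (LinearMap.range_comp_le_range E V)) ?_
  · exact h ▸ LinearMap.range_comp_le_range V T
  · rintro _ ⟨⟨y, rfl⟩, u, hu⟩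
    refine ⟨u, ?_⟩
    calc (V ∘ₗ E) u = T (V u) := LinearMap.congr_fun h u
      _ = (T * T) y := congrArg T hu
      _ = T y := by rw [hT.eq]

end Range

section Compression

variable {𝕜 H : Type*} [RCLike 𝕜] [NormedAddCommGroup H] [InnerProductSpace 𝕜 H]
  (K : Submodule 𝕜 H) [K.HasOrthogonalProjection] {T : H →L[𝕜] H}

/-- The compression `P T|_K` of a bounded operator `T` to a closed subspace `K` with orthogonal
projection `P`.  It is defined whether or not `T` maps `K` into itself; when it does, the
compression is the restriction of `T`. -/
def compression (T : H →L[𝕜] H) : K →L[𝕜] K :=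
  K.orthogonalProjectionOnto ∘L T ∘L K.subtypeL

variable {K}

theorem coe_compression_of_mem_invtSubmodule
    (hK : K ∈ Module.End.invtSubmodule (T : H →ₗ[𝕜] H)) (x : K) : (compression K T x : H) = T x :=
  K.starProjection_eq_self_iff.2 (hK x.2)

theorem coe_compression_of_commute (hT : Commute T K.starProjection) (x : K) :
    (compression K T x : H) = T x :=
  calc (compression K T x : H) = T (K.starProjection x) := (DFunLike.congr_fun hT.eq (x : H)).symm
    _ = T x := by rw [K.starProjection_eq_self_iff.2 x.2]

theorem compression_orthogonalProjectionOnto_of_commute (hT : Commute T K.starProjection) (x : H) :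
    compression K T (K.orthogonalProjectionOnto x) = K.orthogonalProjectionOnto (T x) :=
  Subtype.ext <| (coe_compression_of_commute hT _).trans (DFunLike.congr_fun hT.eq x)

theorem commute_starProjection_orthogonal (hT : Commute T K.starProjection) :
    Commute T Kᗮ.starProjection := by
  rw [K.starProjection_orthogonal']
  exact (Commute.one_right T).sub_right hT

theorem isSelfAdjoint_compression [CompleteSpace H] [CompleteSpace K] (hT : IsSelfAdjoint T) :
    IsSelfAdjoint (compression K T) := by
  have h := hT.adjoint_conj K.subtypeL
  rwa [K.adjoint_subtypeL] at h

end Compression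

section Intertwining

variable {𝕜 H₁ H₂ : Type*} [RCLike 𝕜]
  [NormedAddCommGroup H₁] [InnerProductSpace 𝕜 H₁] [CompleteSpace H₁]
  [NormedAddCommGroup H₂] [InnerProductSpace 𝕜 H₂] [CompleteSpace H₂]

/-- The pair `(Q₁, Q₂)` intertwines `Γ : H₂ → H₁` and its adjoint: `Q₁ Γ = Γ Q₂` and
`Q₂ Γ† = Γ† Q₁`.  Equivalently, `Q₁ ⊕ Q₂` commutes with the off-diagonal block operator
`[0, Γ; Γ†, 0]`. -/
structure Intertwines (Γ : H₂ →L[𝕜] H₁) (Q₁ : H₁ →L[𝕜] H₁) (Q₂ : H₂ →L[𝕜] H₂) : Prop where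
  comp_eq : Q₁ ∘L Γ = Γ ∘L Q₂
  comp_adjoint_eq : Q₂ ∘L Γ† = Γ† ∘L Q₁

theorem Intertwines.of_isSelfAdjoint
    {Γ : H₂ →L[𝕜] H₁} {Q₁ : H₁ →L[𝕜] H₁} {Q₂ : H₂ →L[𝕜] H₂}
    (hQ₁ : IsSelfAdjoint Q₁) (hQ₂ : IsSelfAdjoint Q₂) (h : Q₁ ∘L Γ = Γ ∘L Q₂) :
    Intertwines Γ Q₁ Q₂ where
  comp_eq := h
  comp_adjoint_eq := by
    simpa only [ContinuousLinearMap.adjoint_comp, hQ₁.adjoint_eq, hQ₂.adjoint_eq]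
      using congrArg ContinuousLinearMap.adjoint h.symm

end Intertwining

section PolarModel

variable {H₁ H₂ : Type*}
  [NormedAddCommGroup H₁] [InnerProductSpace ℂ H₁] [NormedAddCommGroup H₂] [InnerProductSpace ℂ H₂]
  {Γ : H₂ →L[ℂ] H₁} {Q₁ : H₁ →L[ℂ] H₁} {Q₂ : H₂ →L[ℂ] H₂}

theorem clRan_mem_invtSubmodule (h : Q₁ ∘L Γ = Γ ∘L Q₂) :
    clRan Γ ∈ Module.End.invtSubmodule (Q₁ : H₁ →ₗ[ℂ] H₁) := by
  refine Submodule.topologicalClosure_mem_invtSubmodule ?_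
  rintro _ ⟨y, rfl⟩
  exact ⟨Q₂ y, (DFunLike.congr_fun h y).symm⟩

variable [CompleteSpace H₁] [CompleteSpace H₂]

theorem Intertwines.commute_absAdjoint (h : Intertwines Γ Q₁ Q₂) : Commute (absAdjoint Γ) Q₁ := by
  have hsq : Commute (Γ ∘L Γ†) Q₁ :=
    calc Γ ∘L Γ† ∘L Q₁ = Γ ∘L Q₂ ∘L Γ† := by rw [h.comp_adjoint_eq]
      _ = Q₁ ∘L Γ ∘L Γ† := by
        rw [← ContinuousLinearMap.comp_assoc, ← h.comp_eq, ContinuousLinearMap.comp_assoc]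
  exact hsq.cfcₙ_nnreal NNReal.sqrt

theorem Intertwines.polarIsometry_compression (h : Intertwines Γ Q₁ Q₂) (y : clRan Γ) :
    (polarIsometry Γ (compression (clRan Γ) Q₁ y) : H₂) = Q₂ (polarIsometry Γ y) := by
  have hdense := denseRange_codRestrict (absAdjoint Γ) (clRan Γ) (clRan_absAdjoint Γ)
    (absAdjoint_mem Γ)
  refine hdense.induction_on y (isClosed_eq (by fun_prop) (by fun_prop)) fun x => ?_
  have hx : compression (clRan Γ) Q₁ ⟨absAdjoint Γ x, absAdjoint_mem Γ x⟩
      = ⟨absAdjoint Γ (Q₁ x), absAdjoint_mem Γ (Q₁ x)⟩ :=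
    Subtype.ext <|
      (coe_compression_of_mem_invtSubmodule (clRan_mem_invtSubmodule h.comp_eq) _).trans
        (DFunLike.congr_fun h.commute_absAdjoint.eq x).symm
  change (polarIsometry Γ (compression (clRan Γ) Q₁ ⟨absAdjoint Γ x, absAdjoint_mem Γ x⟩) : H₂)
    = Q₂ (polarIsometry Γ ⟨absAdjoint Γ x, absAdjoint_mem Γ x⟩)
  rw [hx, polarIsometry_absAdjoint, polarIsometry_absAdjoint]
  exact (DFunLike.congr_fun h.comp_adjoint_eq x).symm

variable {H₀ : Type*} [NormedAddCommGroup H₀] [InnerProductSpace ℂ H₀] (M : Model Γ H₀)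

theorem Model.polarIsometry_U₁ (u : H₀) : polarIsometry Γ (M.U₁ u) = M.U₂ u := by
  rw [← M.symm_trans, LinearIsometryEquiv.trans_apply, LinearIsometryEquiv.symm_apply_apply]

theorem Model.U₁_Γ₀ (u : H₀) : (M.U₁ (M.Γ₀ u) : H₁) = Γ (M.U₂ u) :=
  congrArg Subtype.val (M.U₁.apply_symm_apply (restrictRan Γ (M.U₂ u)))

/-- The operator `U₁⁻¹ Q U₁` on the model space, induced by a bounded operator `Q` on `H₁`; at
the `H₁`-block of `π A` it is `E_π A`.  The compression to the closure of `Ran Γ` makes it defined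
for every `Q`. -/
def Model.induced (Q : H₁ →L[ℂ] H₁) : H₀ →L[ℂ] H₀ :=
  (M.U₁.symm : clRan Γ →L[ℂ] H₀) ∘L compression (clRan Γ) Q ∘L (M.U₁ : H₀ →L[ℂ] clRan Γ)

theorem Model.U₁_induced (Q : H₁ →L[ℂ] H₁) (u : H₀) :
    M.U₁ (M.induced Q u) = compression (clRan Γ) Q (M.U₁ u) :=
  M.U₁.apply_symm_apply _

theorem Intertwines.coe_U₁_induced (h : Intertwines Γ Q₁ Q₂) (u : H₀) :
    (M.U₁ (M.induced Q₁ u) : H₁) = Q₁ (M.U₁ u) := by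
  rw [M.U₁_induced, coe_compression_of_mem_invtSubmodule (clRan_mem_invtSubmodule h.comp_eq)]

theorem Intertwines.coe_U₂_induced (h : Intertwines Γ Q₁ Q₂) (u : H₀) :
    (M.U₂ (M.induced Q₁ u) : H₂) = Q₂ (M.U₂ u) := by
  rw [← M.polarIsometry_U₁, M.U₁_induced, h.polarIsometry_compression, M.polarIsometry_U₁]

theorem Intertwines.commute_induced_Γ₀ (h : Intertwines Γ Q₁ Q₂) :
    Commute (M.induced Q₁) M.Γ₀ := by
  refine ContinuousLinearMap.ext fun u => M.U₁.injective <| Subtype.ext ?_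
  calc (M.U₁ (M.induced Q₁ (M.Γ₀ u)) : H₁) = Q₁ (Γ (M.U₂ u)) := by
        rw [h.coe_U₁_induced, M.U₁_Γ₀]
    _ = Γ (Q₂ (M.U₂ u)) := DFunLike.congr_fun h.comp_eq _
    _ = M.U₁ (M.Γ₀ (M.induced Q₁ u)) := by rw [M.U₁_Γ₀, h.coe_U₂_induced]

end PolarModel

section Resolution

variable {H H₀ X : Type*} [NormedAddCommGroup H] [InnerProductSpace ℂ H] [CompleteSpace H]
  [NormedAddCommGroup H₀] [InnerProductSpace ℂ H₀] [CompleteSpace H₀] [MeasurableSpace X]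

theorem IsResolutionOfIdentity.of_isometry {π : Set X → H →L[ℂ] H}
    (hπ : IsResolutionOfIdentity π) {V : H₀ →L[ℂ] H} (hV : Isometry V) {E : Set X → H₀ →L[ℂ] H₀}
    (hE : ∀ A, MeasurableSet A → V ∘L E A = π A ∘L V) : IsResolutionOfIdentity E := by
  have hVE (A : Set X) (hA : MeasurableSet A) (u : H₀) : V (E A u) = π A (V u) :=
    DFunLike.congr_fun (hE A hA) u
  have ext_V {S T : H₀ →L[ℂ] H₀} (h : ∀ u, V (S u) = V (T u)) : S = T :=
    ContinuousLinearMap.ext fun u => hV.injective (h u)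
  have E_eq (A : Set X) (hA : MeasurableSet A) : V† ∘L π A ∘L V = E A := by
    rw [← hE A hA, ← ContinuousLinearMap.comp_assoc,
      V.isometry_iff_adjoint_comp_self.1 hV, ContinuousLinearMap.one_def,
      ContinuousLinearMap.id_comp]
  refine ⟨fun A hA => ⟨ext_V fun u => ?_, ?_⟩, ext_V fun u => ?_, ext_V fun u => ?_,
    fun A hA => ext_V fun u => ?_, fun A B hA hB => ext_V fun u => ?_,
    fun A B hA hB hAB => ext_V fun u => ?_, fun A hA hAnti v => ?_⟩
  · simp only [mul_apply_eq_comp, hVE A hA]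
    exact DFunLike.congr_fun (hπ.isStarProjection A hA).isIdempotentElem.eq (V u)
  · exact E_eq A hA ▸ (hπ.isStarProjection A hA).isSelfAdjoint.adjoint_conj V
  · simp [hVE ∅ .empty, hπ.empty]
  · simp [hVE _ .univ, hπ.univ]
  · simp [hVE _ hA.compl, hVE A hA, hπ.compl A hA]
  · simp [hVE _ (hA.inter hB), hVE A hA, hVE B hB, hπ.inter A B hA hB]
  · simp [hVE _ (hA.union hB), hVE A hA, hVE B hB, hπ.union A B hA hB hAB]
  · rw [hV.isEmbedding.tendsto_nhds_iff]
    simpa only [Function.comp_def, hVE _ (hA _), hVE _ (MeasurableSet.iInter hA)]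
      using hπ.iInter A hA hAnti (V v)

end Resolution

section System

variable {H : Type*} [NormedAddCommGroup H] [InnerProductSpace ℂ H] [CompleteSpace H]
  {H₁ : Submodule ℂ H} [CompleteSpace H₁]

section Block

variable {Ω₁ : H₁ →ₗ.[ℂ] H₁} {Ω₂ : H₁ᗮ →ₗ.[ℂ] H₁ᗮ} {Γ : H₁ᗮ →L[ℂ] H₁}

theorem orthogonalProjectionOnto_blockOperator (v : (blockOperator H₁ Ω₁ Ω₂ Γ).domain) :
    H₁.orthogonalProjectionOnto (blockOperator H₁ Ω₁ Ω₂ Γ v)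
      = Ω₁ ⟨H₁.orthogonalProjectionOnto v, v.2.1⟩ + Γ (H₁ᗮ.orthogonalProjectionOnto (v : H)) := by
  change H₁.orthogonalProjectionOnto (((_ : H₁) : H) + ((_ : H₁ᗮ) : H)) = _
  rw [map_add, H₁.orthogonalProjectionOnto_mem_subspace_eq_self,
    H₁.orthogonalProjectionOnto_apply_of_mem_orthogonal (Subtype.property _), add_zero]

theorem orthogonalProjectionOnto_blockOperator_coe {y : H₁ᗮ}
    (hy : (y : H) ∈ (blockOperator H₁ Ω₁ Ω₂ Γ).domain) :
    H₁.orthogonalProjectionOnto (blockOperator H₁ Ω₁ Ω₂ Γ ⟨y, hy⟩) = Γ y := by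
  have hzero : (⟨H₁.orthogonalProjectionOnto (y : H), hy.1⟩ : Ω₁.domain) = 0 :=
    Subtype.ext (H₁.orthogonalProjectionOnto_apply_of_mem_orthogonal y.2)
  rw [orthogonalProjectionOnto_blockOperator, hzero, Ω₁.map_zero, zero_add,
    H₁ᗮ.orthogonalProjectionOnto_mem_subspace_eq_self]

theorem coe_mem_domain_blockOperator {y : H₁ᗮ} (hy : y ∈ Ω₂.domain) :
    (y : H) ∈ (blockOperator H₁ Ω₁ Ω₂ Γ).domain := by
  refine ⟨?_, ?_⟩
  · change H₁.orthogonalProjectionOnto (y : H) ∈ Ω₁.domain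
    rw [H₁.orthogonalProjectionOnto_apply_of_mem_orthogonal y.2]
    exact Ω₁.domain.zero_mem
  · change H₁ᗮ.orthogonalProjectionOnto (y : H) ∈ Ω₂.domain
    rwa [H₁ᗮ.orthogonalProjectionOnto_mem_subspace_eq_self]

theorem dense_domain_of_dense_domain_blockOperator
    (hΩ : Dense ((blockOperator H₁ Ω₁ Ω₂ Γ).domain : Set H)) : Dense (Ω₂.domain : Set H₁ᗮ) := by
  have hsurj : Function.Surjective H₁ᗮ.orthogonalProjectionOnto := fun y =>
    ⟨y, H₁ᗮ.orthogonalProjectionOnto_mem_subspace_eq_self y⟩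
  refine (hsurj.denseRange.dense_image H₁ᗮ.orthogonalProjectionOnto.continuous hΩ).mono ?_
  rintro _ ⟨v, hv, rfl⟩
  exact hv.2

theorem compression_comp_coupling (hΩ : Dense ((blockOperator H₁ Ω₁ Ω₂ Γ).domain : Set H))
    {T : H →L[ℂ] H} (hTP : Commute T H₁.starProjection)
    (hTΩ : ∀ v : (blockOperator H₁ Ω₁ Ω₂ Γ).domain,
      ∃ h : T (v : H) ∈ (blockOperator H₁ Ω₁ Ω₂ Γ).domain,
        T (blockOperator H₁ Ω₁ Ω₂ Γ v) = blockOperator H₁ Ω₁ Ω₂ Γ ⟨T (v : H), h⟩) :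
    compression H₁ T ∘L Γ = Γ ∘L compression H₁ᗮ T := by
  refine DFunLike.coe_injective <| Continuous.ext_on
    (dense_domain_of_dense_domain_blockOperator hΩ) (ContinuousLinearMap.continuous _)
    (ContinuousLinearMap.continuous _) fun y hy => ?_
  have hyΩ := coe_mem_domain_blockOperator (Ω₁ := Ω₁) (Γ := Γ) hy
  obtain ⟨hTy, hcomm⟩ := hTΩ ⟨y, hyΩ⟩
  have hT₂y := coe_compression_of_commute (commute_starProjection_orthogonal hTP) y
  simp only [← hT₂y] at hTy hcomm
  calc compression H₁ T (Γ y)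
      = H₁.orthogonalProjectionOnto (T (blockOperator H₁ Ω₁ Ω₂ Γ ⟨y, hyΩ⟩)) := by
        rw [← orthogonalProjectionOnto_blockOperator_coe hyΩ,
          compression_orthogonalProjectionOnto_of_commute hTP]
    _ = Γ (compression H₁ᗮ T y) := by
        rw [hcomm, orthogonalProjectionOnto_blockOperator_coe hTy]

end Block

variable {H₀ : Type*} [NormedAddCommGroup H₀] [InnerProductSpace ℂ H₀]
  {Γ : H₁ᗮ →L[ℂ] H₁} (M : Model Γ H₀)

theorem Model.isometry_V₁ : Isometry M.V₁ :=
  AddMonoidHomClass.isometry_of_norm M.V₁ M.U₁.norm_map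

theorem Model.range_V₁ : M.V₁.range = H₁Γ Γ := by
  change (H₁.subtype ∘ₗ (clRan Γ).subtype ∘ₗ (M.U₁.toLinearEquiv : H₀ →ₗ[ℂ] clRan Γ)).range = _
  rw [LinearMap.range_comp, LinearMap.range_comp, LinearEquiv.range, Submodule.map_subtype_top,
    H₁Γ]

theorem Model.range_V₂ : M.V₂.range = H₂Γ Γ := by
  change (H₁ᗮ.subtype ∘ₗ (clRan (Γ†)).subtype ∘ₗ
    (M.U₂.toLinearEquiv : H₀ →ₗ[ℂ] clRan (Γ†))).range = _
  rw [LinearMap.range_comp, LinearMap.range_comp, LinearEquiv.range, Submodule.map_subtype_top,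
    H₂Γ]

variable {T : H →L[ℂ] H}

theorem Model.V₁_comp_induced (hTP : Commute T H₁.starProjection)
    (h : Intertwines Γ (compression H₁ T) (compression H₁ᗮ T)) :
    M.V₁ ∘L M.induced (compression H₁ T) = T ∘L M.V₁ :=
  ContinuousLinearMap.ext fun u => (congrArg Subtype.val (h.coe_U₁_induced M u)).trans
    (coe_compression_of_commute hTP _)

theorem Model.V₂_comp_induced (hTP : Commute T H₁.starProjection)
    (h : Intertwines Γ (compression H₁ T) (compression H₁ᗮ T)) :
    M.V₂ ∘L M.induced (compression H₁ T) = T ∘L M.V₂ :=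
  ContinuousLinearMap.ext fun u => (congrArg Subtype.val (h.coe_U₂_induced M u)).trans
    (coe_compression_of_commute (commute_starProjection_orthogonal hTP) _)

end System

end CoupledSystem

end

open CoupledSystem in
theorem mainTheorem7_general
    {H : Type*} [NormedAddCommGroup H] [InnerProductSpace ℂ H] [CompleteSpace H]
    (H₁ : Submodule ℂ H) [CompleteSpace H₁]
    (Ω₁ : H₁ →ₗ.[ℂ] H₁) (Ω₂ : H₁ᗮ →ₗ.[ℂ] H₁ᗮ) (Γ : H₁ᗮ →L[ℂ] H₁)
    (hΩ : Dense ((blockOperator H₁ Ω₁ Ω₂ Γ).domain : Set H))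
    {H₀ : Type*} [NormedAddCommGroup H₀] [InnerProductSpace ℂ H₀] [CompleteSpace H₀]
    (M : Model Γ H₀) {X : Type*} [MeasurableSpace X] (π : Set X → H →L[ℂ] H)
    (hπ : IsResolutionOfIdentity π)
    (hπΩ : CommutesWithUnbounded π (blockOperator H₁ Ω₁ Ω₂ Γ))
    (hπP : CommutesWith π H₁.starProjection) :
    ∃ E : Set X → H₀ →L[ℂ] H₀,
      IsResolutionOfIdentity E ∧
      CommutesWith E M.Γ₀ ∧
      (∀ A, MeasurableSet A →
        M.V₁ ∘L E A = π A ∘L M.V₁ ∧ M.V₂ ∘L E A = π A ∘L M.V₂) ∧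
      (∀ A, MeasurableSet A →
        (M.V₁ ∘L E A).range = (π A).range ⊓ H₁Γ Γ ∧
        (M.V₂ ∘L E A).range = (π A).range ⊓ H₂Γ Γ) := by
  have intertwines (A) (hA : MeasurableSet A) :
      Intertwines Γ (compression H₁ (π A)) (compression H₁ᗮ (π A)) :=
    have hsa := (hπ.isStarProjection A hA).isSelfAdjoint
    .of_isSelfAdjoint (isSelfAdjoint_compression hsa) (isSelfAdjoint_compression hsa)
      (compression_comp_coupling hΩ (hπP A hA) (hπΩ A hA))
  have hV₁ (A) (hA : MeasurableSet A) := M.V₁_comp_induced (hπP A hA) (intertwines A hA)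
  have hV₂ (A) (hA : MeasurableSet A) := M.V₂_comp_induced (hπP A hA) (intertwines A hA)
  refine ⟨fun A => M.induced (compression H₁ (π A)), hπ.of_isometry M.isometry_V₁ hV₁,
    fun A hA => (intertwines A hA).commute_induced_Γ₀ M,
    fun A hA => ⟨hV₁ A hA, hV₂ A hA⟩, fun A hA => ?_⟩
  have hidem := ContinuousLinearMap.IsIdempotentElem.toLinearMap
    (hπ.isStarProjection A hA).isIdempotentElem
  rw [← M.range_V₁, ← M.range_V₂]
  exact ⟨range_comp_eq_range_inf_range hidem (congrArg ContinuousLinearMap.toLinearMap (hV₁ A hA)),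
    range_comp_eq_range_inf_range hidem (congrArg ContinuousLinearMap.toLinearMap (hV₂ A hA))⟩

theorem mainTheorem7
    {H : Type*} [NormedAddCommGroup H] [InnerProductSpace ℂ H] [CompleteSpace H]
    (H₁ : Submodule ℂ H) [CompleteSpace H₁]
    (Ω₁ : H₁ →ₗ.[ℂ] H₁) (Ω₂ : H₁ᗮ →ₗ.[ℂ] H₁ᗮ) (Γ : H₁ᗮ →L[ℂ] H₁)
    (Ω : H →ₗ.[ℂ] H) (hΩ : Ω = CoupledSystem.blockOperator H₁ Ω₁ Ω₂ Γ)
    (hΩ_sa : IsSelfAdjoint Ω)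
    {H₀ : Type*} [NormedAddCommGroup H₀] [InnerProductSpace ℂ H₀] [CompleteSpace H₀]
    (M : CoupledSystem.Model Γ H₀)
    {X : Type*} [MeasurableSpace X] (π : Set X → H →L[ℂ] H)
    (hπ : CoupledSystem.IsResolutionOfIdentity π)
    (hπΩ : CoupledSystem.CommutesWithUnbounded π Ω)
    (hπP : CoupledSystem.CommutesWith π H₁.starProjection) :
    ∃ E : Set X → H₀ →L[ℂ] H₀,
      CoupledSystem.IsResolutionOfIdentity E ∧
      CoupledSystem.CommutesWith E M.Γ₀ ∧
      (∀ A, MeasurableSet A →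
        M.V₁ ∘L E A = π A ∘L M.V₁ ∧ M.V₂ ∘L E A = π A ∘L M.V₂) ∧
      (∀ A, MeasurableSet A →
        (M.V₁ ∘L E A).range = (π A).range ⊓ CoupledSystem.H₁Γ Γ ∧
        (M.V₂ ∘L E A).range = (π A).range ⊓ CoupledSystem.H₂Γ Γ) := by
  subst hΩ
  exact mainTheorem7_general H₁ Ω₁ Ω₂ Γ hΩ_sa.dense_domain M π hπ hπΩ hπP
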